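/- There are universal constants $C_1, C_2, C_3, c > 0$ such that the following holds for all integers $s, d, n$ with $s \ge 1$ and all $\tau > 0$ satisfying $$n \ge C_1 s^2 \log d, \qquad C_2\sqrt{\frac{\log d}{n}} \le \tau \le c, \qquad d \ge s + \frac{C_3}{\tau}.$$ There are a unit vector $v \in \mathbb{R}^d$ with exactly $s$ nonzero entries and a positive semidefinite matrix $\Sigma \in \mathbb{R}^{d\times d}$, having $v$ as an eigenvector for its largest eigenvalue $\lambda_1(\Sigma) > 0$ and satisfying $\lambda_2(\Sigma) \le 0.9\,\lambda_1(\Sigma)$, such that there is a $1$-sub-Gaussian distribution with covariance $\Sigma$, and for every $1$-sub-Gaussian distribution $\mathcal{D}$ on $\mathbb{R}^d$ with covariance $\Sigma$ the following is true. Let $x_1, \dots, x_n$ be i.i.d. samples from $\mathcal{D}$, let $\widehat\Sigma = \frac1n \sum_{i=1}^n x_i x_i^\top$, and let $\mathcal{T}_\tau(\widehat\Sigma)$ be obtained from $\widehat\Sigma$ by replacing each entry of absolute value less than $\tau$ by $0$. Then, with probability at least $\frac12$, every eigenvector $u$ of $\mathcal{T}_\tau(\widehat\Sigma)$ for its largest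 eigenvalue (hence the output of covariance thresholding, however ties are broken) satisfies $\sin^2\angle(u, v) = 1$, where $\sin^2\angle(u,v) := 1 - \frac{\langle u, v\rangle^2}{\|u\|_2^2\|v\|_2^2}$. Here $\lambda_i$ denotes the $i$-th largest eigenvalue counted with multiplicity, and $\mathcal{D}$ is $1$-sub-Gaussian if $\mathbb{E}_{x\sim\mathcal{D}}[\exp(w^\top x)] \le \exp(\frac12\|w\|_2^2)$ for all $w \in \mathbb{R}^d$. -/

import Mathlib

open MeasureTheory ProbabilityTheory
open scoped Matrix

namespace SparsePCA

/-- Vectors are functions `Fin d → ℝ`, with Euclidean inner product `u ⬝ᵥ w`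
and squared Euclidean norm `u ⬝ᵥ u`. This is the number of nonzero entries. -/
noncomputable def nnz {d : ℕ} (v : Fin d → ℝ) : ℕ :=
  {i | v i ≠ 0}.ncard

/-- `sin² ∠(u, v) = 1 - ⟨u, v⟩² / (‖u‖² ‖v‖²)`. -/
noncomputable def sinSqAngle {d : ℕ} (u v : Fin d → ℝ) : ℝ :=
  1 - (u ⬝ᵥ v) ^ 2 / ((u ⬝ᵥ u) * (v ⬝ᵥ v))

/-- `lam hM i` is the `i`-th largest eigenvalue of the real symmetric matrix `M`, counted with
multiplicity, for `1 ≤ i ≤ d` (`eigenvalues₀` lists the eigenvalues in nonincreasing order, starting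
with index `0`); for other `i` the value is `0`. -/
noncomputable def lam {d : ℕ} {M : Matrix (Fin d) (Fin d) ℝ} (hM : M.IsHermitian) (i : ℕ) : ℝ :=
  if h : 1 ≤ i ∧ i ≤ d then
    hM.eigenvalues₀ ⟨i - 1, by rw [Fintype.card_fin]; omega⟩
  else 0

/-- `u` is an eigenvector of the symmetric matrix `M` for its largest eigenvalue. -/
def IsTopEigenvector {d : ℕ} {M : Matrix (Fin d) (Fin d) ℝ} (hM : M.IsHermitian)
    (u : Fin d → ℝ) : Prop :=
  u ≠ 0 ∧ M *ᵥ u = lam hM 1 • u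

/-- Conditions of the general sparse PCA model on the covariance `S` and the vector `v`: `S` is
positive semidefinite, `v` is a unit vector with at most `s` nonzero entries and a top eigenvector
of `S`, and `λ₂(S) ≤ 0.9 λ₁(S)` with `λ₁(S) > 0`. -/
structure GeneralModel {d : ℕ} (s : ℕ) (v : Fin d → ℝ) (S : Matrix (Fin d) (Fin d) ℝ) : Prop where
  posSemidef : S.PosSemidef
  unit : v ⬝ᵥ v = 1
  sparse : nnz v ≤ s
  top : IsTopEigenvector posSemidef.isHermitian v
  pos : 0 < lam posSemidef.isHermitian 1
  gap : lam posSemidef.isHermitian 2 ≤ 0.9 * lam posSemidef.isHermitian 1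

/-- The distribution `D` on `ℝ^d` is `σ`-sub-Gaussian:
`E exp(uᵀx) ≤ exp(σ² ‖u‖² / 2)` for every `u`, where the expectation is finite. -/
def IsSubGaussian {d : ℕ} (σ : ℝ) (D : Measure (Fin d → ℝ)) : Prop :=
  ∀ u : Fin d → ℝ, Integrable (fun x => Real.exp (u ⬝ᵥ x)) D ∧
    ∫ x, Real.exp (u ⬝ᵥ x) ∂D ≤ Real.exp (1 / 2 * σ ^ 2 * (u ⬝ᵥ u))

/-- `S` is the covariance matrix of the distribution `D` on `ℝ^d`. -/
def HasCovarianceMatrix {d : ℕ} (D : Measure (Fin d → ℝ)) (S : Matrix (Fin d) (Fin d) ℝ) : Prop :=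
  ∀ i j, covariance (fun x => x i) (fun x => x j) D = S i j

/-- `(1/n) ∑ₖ xₖ xₖᵀ`. -/
noncomputable def sampleCov {n d : ℕ} (x : Fin n → Fin d → ℝ) : Matrix (Fin d) (Fin d) ℝ :=
  (1 / (n : ℝ)) • ∑ k, Matrix.vecMulVec (x k) (x k)

/-- Hard thresholding of a number at level `τ`. -/
noncomputable def thresh (τ c : ℝ) : ℝ :=
  if τ ≤ |c| then c else 0

/-- The sample covariance matrix, thresholded entrywise at `τ`. -/
noncomputable def thresholdedCov {n d : ℕ} (τ : ℝ) (x : Fin n → Fin d → ℝ) :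
    Matrix (Fin d) (Fin d) ℝ :=
  (sampleCov x).map (thresh τ)

theorem thresholdedCov_isHermitian {n d : ℕ} (τ : ℝ) (x : Fin n → Fin d → ℝ) :
    (thresholdedCov τ x).IsHermitian := by
  ext i j
  simp [thresholdedCov, sampleCov, Matrix.sum_apply, Matrix.vecMulVec_apply, mul_comm]

/-- `u` is a possible output of covariance thresholding at level `τ` on the data `x`: a top
eigenvector of the entrywise thresholded sample covariance matrix. (The top eigenspace may have
dimension greater than one, whence a relation.) -/
def IsCovThreshOutput {n d : ℕ} (τ : ℝ) (x : Fin n → Fin d → ℝ) (u : Fin d → ℝ) : Prop :=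
  IsTopEigenvector (thresholdedCov_isHermitian τ x) u

end SparsePCA

namespace SparsePCA

/-! Thresholding can raise an eigenvalue by deleting negative entries. Put the spike `vvᵀ` on `I`,
with eigenvalue 1, beside a block on `P ∪ Q` with `|P| = |Q| = m`, with off-diagonal entries
`-0.3/m` inside `P` and inside `Q`, `0.45/m` across, and `3/4 - 0.3/m` on the diagonal. On the block
the all-ones vector has eigenvalue `3/4 - 0.3 + 0.45 = 0.9`, the vector with signs opposite on `P`
and `Q` has eigenvalue 0, and all else has 3/4; so the spike is on top with the required gap. If
`mτ` lies between 0.35 and 0.4, thresholding at `τ` removes `-0.3/m` and keeps `0.45/m`, and the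
all-ones direction rises to nearly 1.2.

This survives entrywise noise of size `τ/20`: `lam_one_thresh_ge` puts the top eigenvalue at 1.1 or
more, while the thresholded block on `I` is decoupled and has absolute row sums at most 1.06. By
`eigenvector_eq_zero_of_row_sums_lt`, top eigenvectors vanish on `I`, hence are orthogonal to `v`.

The noise bound is a Bernstein estimate for products of sub-Gaussian coordinates
(`mgf_mul_sub_integral_le`), followed by Chernoff and a union bound over the `d²` entries
(`pi_real_exists_entry_far_le`). A centred Gaussian shows that the class of distributions is
nonempty. -/

/-! ### Rayleigh quotients and the two largest eigenvalues. -/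

theorem exists_orthonormal_eigenvectors {d : ℕ} {M : Matrix (Fin d) (Fin d) ℝ}
    (hM : M.IsHermitian) :
    ∃ b : OrthonormalBasis (Fin d) ℝ (EuclideanSpace ℝ (Fin d)),
      (∀ k : Fin d, M *ᵥ ⇑(b k) = lam hM (k + 1) • ⇑(b k)) ∧
      (∀ k l : Fin d, k ≤ l → lam hM (l + 1) ≤ lam hM (k + 1)) := by
  have hlam : ∀ k : Fin d, lam hM (k + 1) = hM.eigenvalues₀ (Fin.cast (by simp) k) := by
    intro k
    have h : 1 ≤ (k : ℕ) + 1 ∧ (k : ℕ) + 1 ≤ d := by omega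
    rw [lam, dif_pos h]
    rfl
  -- Mathlib's eigenbasis is indexed through an arbitrary equivalence of types of equal cardinality;
  -- `e` undoes it, so that position `k` carries the eigenvalue `lam hM (k + 1)`.
  let e : Fin d ≃ Fin d :=
    (finCongr (Fintype.card_fin d).symm).trans
      (Fintype.equivOfCardEq (Fintype.card_fin _))
  refine ⟨hM.eigenvectorBasis.reindex e.symm, fun k => ?_, fun k l hkl => ?_⟩
  · rw [OrthonormalBasis.reindex_apply, Equiv.symm_symm, hM.mulVec_eigenvectorBasis, hlam]
    congr 1
    simp [Matrix.IsHermitian.eigenvalues, e]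
  · rw [hlam, hlam]
    exact hM.eigenvalues₀_antitone (by simpa using hkl)

theorem dotProduct_self_eq_one_of_orthonormalBasis {d : ℕ}
    (b : OrthonormalBasis (Fin d) ℝ (EuclideanSpace ℝ (Fin d))) (k : Fin d) :
    (b k) ⬝ᵥ (⇑(b k) : Fin d → ℝ) = 1 := by
  rw [← b.inner_eq_one k, EuclideanSpace.inner_eq_star_dotProduct, star_trivial]

theorem quadForm_eq_sum {d : ℕ} {M : Matrix (Fin d) (Fin d) ℝ} (hM : M.IsHermitian)
    (b : OrthonormalBasis (Fin d) ℝ (EuclideanSpace ℝ (Fin d))) (μ : Fin d → ℝ)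
    (hb : ∀ k, M *ᵥ ⇑(b k) = μ k • ⇑(b k)) (w : Fin d → ℝ) :
    w ⬝ᵥ M *ᵥ w = ∑ k, μ k * (w ⬝ᵥ ⇑(b k)) ^ 2 ∧ w ⬝ᵥ w = ∑ k, (w ⬝ᵥ ⇑(b k)) ^ 2 := by
  have key : ∀ x y : Fin d → ℝ, x ⬝ᵥ y = ∑ k, (x ⬝ᵥ ⇑(b k)) * (y ⬝ᵥ ⇑(b k)) := by
    intro x y
    have h := b.sum_inner_mul_inner (WithLp.toLp 2 x) (WithLp.toLp 2 y)
    simp only [EuclideanSpace.inner_eq_star_dotProduct, star_trivial] at h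
    rw [dotProduct_comm, ← h]
    exact Finset.sum_congr rfl fun k _ => by rw [dotProduct_comm x]
  have hT : Mᵀ = M := by simpa using hM.eq
  refine ⟨?_, ?_⟩
  · rw [key]
    refine Finset.sum_congr rfl fun k _ => ?_
    have : (M *ᵥ w) ⬝ᵥ ⇑(b k) = μ k * (w ⬝ᵥ ⇑(b k)) := by
      rw [dotProduct_comm, Matrix.dotProduct_mulVec, ← Matrix.mulVec_transpose, hT, hb,
        smul_dotProduct, smul_eq_mul, dotProduct_comm]
    rw [this]; ring
  · rw [key]
    exact Finset.sum_congr rfl fun k _ => by ring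

theorem quadForm_le_lam_one {d : ℕ} {M : Matrix (Fin d) (Fin d) ℝ} (hM : M.IsHermitian)
    (w : Fin d → ℝ) : w ⬝ᵥ M *ᵥ w ≤ lam hM 1 * (w ⬝ᵥ w) := by
  obtain ⟨b, hb, hmono⟩ := exists_orthonormal_eigenvectors hM
  obtain ⟨h1, h2⟩ := quadForm_eq_sum hM b _ hb w
  rw [h1, h2, Finset.mul_sum]
  refine Finset.sum_le_sum fun k _ => mul_le_mul_of_nonneg_right ?_ (sq_nonneg _)
  have hd : 0 < d := k.pos
  exact hmono ⟨0, hd⟩ k (Nat.zero_le _)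

theorem lam_one_le {d : ℕ} {M : Matrix (Fin d) (Fin d) ℝ} (hM : M.IsHermitian) {c : ℝ}
    (hc : 0 ≤ c) (h : ∀ w : Fin d → ℝ, w ⬝ᵥ M *ᵥ w ≤ c * (w ⬝ᵥ w)) : lam hM 1 ≤ c := by
  obtain ⟨b, hb, -⟩ := exists_orthonormal_eigenvectors hM
  rcases Nat.eq_zero_or_pos d with hd | hd
  · subst hd; simpa [lam] using hc
  · have h1 : (b ⟨0, hd⟩) ⬝ᵥ (⇑(b ⟨0, hd⟩) : Fin d → ℝ) = 1 :=
      dotProduct_self_eq_one_of_orthonormalBasis b _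
    have h2 := h (b ⟨0, hd⟩)
    rw [hb, dotProduct_smul, h1] at h2
    simpa using h2

/-- The easy half of the Courant–Fischer principle for the second eigenvalue. -/
theorem lam_two_le {d : ℕ} {M : Matrix (Fin d) (Fin d) ℝ} (hM : M.IsHermitian) {c : ℝ}
    (hc : 0 ≤ c) (v : Fin d → ℝ)
    (h : ∀ w : Fin d → ℝ, w ⬝ᵥ v = 0 → w ⬝ᵥ M *ᵥ w ≤ c * (w ⬝ᵥ w)) : lam hM 2 ≤ c := by
  obtain ⟨b, hb, hmono⟩ := exists_orthonormal_eigenvectors hM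
  by_cases hd : 2 ≤ d
  swap
  -- In dimension below 2 the value of `lam` is its default 0, which is why `c` must be nonnegative.
  · rw [lam, dif_neg (by omega)]; exact hc
  set k0 : Fin d := ⟨0, by omega⟩ with hk0
  set k1 : Fin d := ⟨1, by omega⟩ with hk1
  have hle : lam hM 2 ≤ lam hM 1 := hmono k0 k1 (by simp [hk0, hk1])
  have hb0 : M *ᵥ ⇑(b k0) = lam hM 1 • ⇑(b k0) := hb k0
  have hb1 : M *ᵥ ⇑(b k1) = lam hM 2 • ⇑(b k1) := hb k1
  have h00 : (b k0) ⬝ᵥ (⇑(b k0) : Fin d → ℝ) = 1 :=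
    dotProduct_self_eq_one_of_orthonormalBasis b _
  have h11 : (b k1) ⬝ᵥ (⇑(b k1) : Fin d → ℝ) = 1 :=
    dotProduct_self_eq_one_of_orthonormalBasis b _
  have h01 : (b k0) ⬝ᵥ (⇑(b k1) : Fin d → ℝ) = 0 := by
    have := b.inner_eq_zero (i := k1) (j := k0) (by simp [hk0, hk1])
    simpa [EuclideanSpace.inner_eq_star_dotProduct] using this
  have h10 : (b k1) ⬝ᵥ (⇑(b k0) : Fin d → ℝ) = 0 := by rw [dotProduct_comm, h01]
  -- The span of the first two eigenvectors contains a nonzero vector orthogonal to `v`, and on this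
  -- span the Rayleigh quotient is at least the second eigenvalue.
  have main : ∀ p q : ℝ, p * (b k0 ⬝ᵥ v) + q * (b k1 ⬝ᵥ v) = 0 →
      p ^ 2 * lam hM 1 + q ^ 2 * lam hM 2 ≤ c * (p ^ 2 + q ^ 2) := by
    intro p q hpq
    have := h (p • ⇑(b k0) + q • ⇑(b k1)) (by
      simpa [add_dotProduct, smul_dotProduct] using hpq)
    simp only [Matrix.mulVec_add, Matrix.mulVec_smul, hb0, hb1, add_dotProduct, smul_dotProduct,
      dotProduct_add, dotProduct_smul, h00, h11, h01, h10, smul_eq_mul] at this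
    linarith
  by_cases hz : b k1 ⬝ᵥ v = 0
  · have := main 0 1 (by rw [hz]; ring)
    linarith
  · have := main (b k1 ⬝ᵥ v) (-(b k0 ⬝ᵥ v)) (by ring)
    have hpos : 0 < (b k1 ⬝ᵥ v) ^ 2 := by positivity
    nlinarith [sq_nonneg (b k0 ⬝ᵥ v), mul_le_mul_of_nonneg_left hle hpos.le]

/-! ### The spiked covariance matrix and its spectrum. -/

/-- The indicator vector of a set of coordinates. -/
def indVec {d : ℕ} (J : Finset (Fin d)) : Fin d → ℝ := fun i => if i ∈ J then 1 else 0

theorem indVec_of_mem {d : ℕ} {J : Finset (Fin d)} {i : Fin d} (h : i ∈ J) : indVec J i = 1 :=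
  if_pos h

theorem indVec_of_notMem {d : ℕ} {J : Finset (Fin d)} {i : Fin d} (h : i ∉ J) :
    indVec J i = 0 :=
  if_neg h

theorem dotProduct_indVec {d : ℕ} (J : Finset (Fin d)) (x : Fin d → ℝ) :
    x ⬝ᵥ indVec J = ∑ i ∈ J, x i := by
  simp [dotProduct, indVec, Finset.sum_ite_mem]

theorem indVec_dotProduct {d : ℕ} (J : Finset (Fin d)) (x : Fin d → ℝ) :
    indVec J ⬝ᵥ x = ∑ i ∈ J, x i := by
  rw [dotProduct_comm, dotProduct_indVec]

theorem sum_indVec {d : ℕ} (J K : Finset (Fin d)) :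
    ∑ i ∈ J, indVec K i = ((J ∩ K).card : ℝ) := by
  simp [indVec, Finset.sum_ite_mem]

theorem sq_sum_le {d : ℕ} (J : Finset (Fin d)) (x : Fin d → ℝ) :
    (∑ i ∈ J, x i) ^ 2 ≤ J.card * ∑ i ∈ J, x i ^ 2 :=
  sq_sum_le_card_mul_sum_sq

theorem sum_sq_le_dotProduct_self {d : ℕ} {I P Q : Finset (Fin d)} (hIP : Disjoint I P)
    (hIQ : Disjoint I Q) (hPQ : Disjoint P Q) (x : Fin d → ℝ) :
    ∑ i ∈ I, x i ^ 2 + ∑ i ∈ P, x i ^ 2 + ∑ i ∈ Q, x i ^ 2 ≤ x ⬝ᵥ x := by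
  rw [← Finset.sum_union hIP,
    ← Finset.sum_union (Finset.disjoint_union_left.2 ⟨hIQ, hPQ⟩), dotProduct]
  simp_rw [← sq]
  exact Finset.sum_le_univ_sum_of_nonneg fun i => sq_nonneg _

/-- A spike `vvᵀ`, with `v` spread evenly over `I`, next to a block on `P ∪ Q` whose positive
entries lie between `P` and `Q` and whose off-diagonal entries inside `P` and inside `Q` are
negative. Its top eigenvalue grows when the negative entries are removed. -/
noncomputable def spikedCov {d : ℕ} (I P Q : Finset (Fin d)) (s m : ℕ) :
    Matrix (Fin d) (Fin d) ℝ :=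
  (1 / (s : ℝ)) • Matrix.vecMulVec (indVec I) (indVec I)
    + (3 / 4 : ℝ) • Matrix.diagonal (indVec P + indVec Q)
    - (3 / 10 / (m : ℝ)) • (Matrix.vecMulVec (indVec P) (indVec P)
        + Matrix.vecMulVec (indVec Q) (indVec Q))
    + (9 / 20 / (m : ℝ)) • (Matrix.vecMulVec (indVec P) (indVec Q)
        + Matrix.vecMulVec (indVec Q) (indVec P))

/-- The unit vector spread evenly over `I`, where `s` is the cardinality of `I`. -/
noncomputable def spike {d : ℕ} (I : Finset (Fin d)) (s : ℕ) : Fin d → ℝ :=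
  (Real.sqrt s)⁻¹ • indVec I

section

variable {d : ℕ} {I P Q : Finset (Fin d)} {s m : ℕ}

theorem spikedCov_apply (i j : Fin d) :
    spikedCov I P Q s m i j = 1 / (s : ℝ) * (indVec I i * indVec I j)
      + 3 / 4 * (if i = j then indVec P i + indVec Q i else 0)
      - 3 / 10 / (m : ℝ) * (indVec P i * indVec P j + indVec Q i * indVec Q j)
      + 9 / 20 / (m : ℝ) * (indVec P i * indVec Q j + indVec Q i * indVec P j) := by
  simp [spikedCov, Matrix.vecMulVec_apply, Matrix.diagonal_apply]
  ring

theorem spikedCov_comm : spikedCov I P Q s m = spikedCov I Q P s m := by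
  ext i j
  simp only [spikedCov_apply]
  split_ifs <;> ring

theorem spikedCov_isHermitian : (spikedCov I P Q s m).IsHermitian := by
  ext i j
  simp only [Matrix.conjTranspose_apply, star_trivial, spikedCov_apply]
  by_cases h : i = j
  · subst h; rfl
  · rw [if_neg h, if_neg (Ne.symm h)]; ring

theorem quadForm_spikedCov (x : Fin d → ℝ) :
    x ⬝ᵥ spikedCov I P Q s m *ᵥ x = 1 / (s : ℝ) * (∑ i ∈ I, x i) ^ 2
      + 3 / 4 * (∑ i ∈ P, x i ^ 2 + ∑ i ∈ Q, x i ^ 2)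
      - 3 / 10 / (m : ℝ) * ((∑ i ∈ P, x i) ^ 2 + (∑ i ∈ Q, x i) ^ 2)
      + 9 / 10 / (m : ℝ) * ((∑ i ∈ P, x i) * ∑ i ∈ Q, x i) := by
  have hdiag : x ⬝ᵥ Matrix.diagonal (indVec P + indVec Q) *ᵥ x
      = ∑ i ∈ P, x i ^ 2 + ∑ i ∈ Q, x i ^ 2 := by
    rw [← dotProduct_indVec P fun i => x i ^ 2, ← dotProduct_indVec Q fun i => x i ^ 2]
    simp only [dotProduct, Matrix.mulVec_diagonal, Pi.add_apply, ← Finset.sum_add_distrib]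
    exact Finset.sum_congr rfl fun i _ => by ring
  have hv : ∀ J K : Finset (Fin d), x ⬝ᵥ Matrix.vecMulVec (indVec J) (indVec K) *ᵥ x
      = (∑ i ∈ J, x i) * ∑ i ∈ K, x i := by
    intro J K
    rw [Matrix.vecMulVec_mulVec, indVec_dotProduct]
    simp [dotProduct_smul, dotProduct_indVec]
  simp only [spikedCov, Matrix.add_mulVec, Matrix.sub_mulVec, Matrix.smul_mulVec, dotProduct_add,
    dotProduct_sub, dotProduct_smul, hdiag, hv, smul_eq_mul]
  ring

/-- By Cauchy–Schwarz, `p²/m` and `q²/m` are at most the squared norms on `P` and `Q`. With `(p ±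
q)² ≥ 0` this confines the form of the block between 0 and 0.9 times the squared norm. Only the
spike can exceed 0.9, and it contributes nothing when the coordinates on `I` sum to 0. -/
theorem quadForm_spikedCov_bounds (hs : 0 < s) (hm : 0 < m) (hI : I.card = s) (hP : P.card = m)
    (hQ : Q.card = m) (hIP : Disjoint I P) (hIQ : Disjoint I Q) (hPQ : Disjoint P Q)
    (x : Fin d → ℝ) :
    0 ≤ x ⬝ᵥ spikedCov I P Q s m *ᵥ x ∧ x ⬝ᵥ spikedCov I P Q s m *ᵥ x ≤ x ⬝ᵥ x ∧
      (∑ i ∈ I, x i = 0 → x ⬝ᵥ spikedCov I P Q s m *ᵥ x ≤ 0.9 * (x ⬝ᵥ x)) := by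
  have hs' : (0 : ℝ) < s := by exact_mod_cast hs
  have hm' : (0 : ℝ) < m := by exact_mod_cast hm
  have hsum := sum_sq_le_dotProduct_self hIP hIQ hPQ x
  have cI := sq_sum_le I x
  have cP := sq_sum_le P x
  have cQ := sq_sum_le Q x
  rw [hI] at cI
  rw [hP] at cP
  rw [hQ] at cQ
  have nI : 0 ≤ ∑ i ∈ I, x i ^ 2 := Finset.sum_nonneg fun i _ => sq_nonneg _
  have nP : 0 ≤ ∑ i ∈ P, x i ^ 2 := Finset.sum_nonneg fun i _ => sq_nonneg _
  have nQ : 0 ≤ ∑ i ∈ Q, x i ^ 2 := Finset.sum_nonneg fun i _ => sq_nonneg _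
  rw [quadForm_spikedCov]
  set a := ∑ i ∈ I, x i
  set p := ∑ i ∈ P, x i
  set q := ∑ i ∈ Q, x i
  have cI' : 1 / (s : ℝ) * a ^ 2 ≤ ∑ i ∈ I, x i ^ 2 := by
    rw [one_div, inv_mul_le_iff₀ hs']; exact cI
  have nI' : 0 ≤ 1 / (s : ℝ) * a ^ 2 := by positivity
  have cP' : 1 / (m : ℝ) * p ^ 2 ≤ ∑ i ∈ P, x i ^ 2 := by
    rw [one_div, inv_mul_le_iff₀ hm']; exact cP
  have cQ' : 1 / (m : ℝ) * q ^ 2 ≤ ∑ i ∈ Q, x i ^ 2 := by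
    rw [one_div, inv_mul_le_iff₀ hm']; exact cQ
  have e1 : 0 ≤ 1 / (m : ℝ) * (p - q) ^ 2 := by positivity
  have e2 : 0 ≤ 1 / (m : ℝ) * (p + q) ^ 2 := by positivity
  have r1 : 3 / 10 / (m : ℝ) * (p ^ 2 + q ^ 2)
      = 3 / 10 * (1 / (m : ℝ) * p ^ 2) + 3 / 10 * (1 / (m : ℝ) * q ^ 2) := by ring
  have r2 : 9 / 10 / (m : ℝ) * (p * q) = 9 / 10 * (1 / (m : ℝ) * (p * q)) := by ring
  have e1' : 1 / (m : ℝ) * (p - q) ^ 2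
      = 1 / (m : ℝ) * p ^ 2 + 1 / (m : ℝ) * q ^ 2 - 2 * (1 / (m : ℝ) * (p * q)) := by ring
  have e2' : 1 / (m : ℝ) * (p + q) ^ 2
      = 1 / (m : ℝ) * p ^ 2 + 1 / (m : ℝ) * q ^ 2 + 2 * (1 / (m : ℝ) * (p * q)) := by ring
  rw [r1, r2]
  refine ⟨by linarith, by linarith, fun ha => ?_⟩
  have : 1 / (s : ℝ) * a ^ 2 = 0 := by rw [ha]; ring
  linarith

theorem spike_dotProduct_self (hs : 0 < s) (hI : I.card = s) :
    spike I s ⬝ᵥ spike I s = 1 := by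
  have hs' : (0 : ℝ) < s := by exact_mod_cast hs
  rw [spike, smul_dotProduct, dotProduct_smul, dotProduct_indVec, sum_indVec, Finset.inter_self,
    hI, smul_eq_mul, smul_eq_mul, ← mul_assoc, ← mul_inv, Real.mul_self_sqrt hs'.le,
    inv_mul_cancel₀ hs'.ne']

theorem nnz_spike (hs : 0 < s) (hI : I.card = s) : nnz (spike I s) = s := by
  have hs' : (0 : ℝ) < s := by exact_mod_cast hs
  have : {i | spike I s i ≠ 0} = (I : Set (Fin d)) := by
    ext i
    simp [spike, indVec, (Real.sqrt_pos.2 hs').ne']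
  rw [nnz, this, Set.ncard_coe_finset, hI]

theorem dotProduct_spike (x : Fin d → ℝ) :
    x ⬝ᵥ spike I s = (Real.sqrt s)⁻¹ * ∑ i ∈ I, x i := by
  rw [spike, dotProduct_smul, dotProduct_indVec, smul_eq_mul]

theorem spikedCov_mulVec_spike (hs : 0 < s) (hI : I.card = s) (hIP : Disjoint I P)
    (hIQ : Disjoint I Q) : spikedCov I P Q s m *ᵥ spike I s = spike I s := by
  have hs' : (s : ℝ) ≠ 0 := by exact_mod_cast hs.ne'
  have hP : indVec P ⬝ᵥ indVec I = 0 := by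
    rw [indVec_dotProduct, sum_indVec, Finset.disjoint_iff_inter_eq_empty.1 hIP.symm]; simp
  have hQ : indVec Q ⬝ᵥ indVec I = 0 := by
    rw [indVec_dotProduct, sum_indVec, Finset.disjoint_iff_inter_eq_empty.1 hIQ.symm]; simp
  have hI' : indVec I ⬝ᵥ indVec I = s := by
    rw [indVec_dotProduct, sum_indVec, Finset.inter_self, hI]
  have hD : Matrix.diagonal (indVec P + indVec Q) *ᵥ indVec I = 0 := by
    ext i
    rw [Matrix.mulVec_diagonal]
    by_cases h : i ∈ I
    · simp [indVec_of_notMem (Finset.disjoint_left.1 hIP h),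
        indVec_of_notMem (Finset.disjoint_left.1 hIQ h)]
    · simp [indVec_of_notMem h]
  rw [spike, Matrix.mulVec_smul]
  congr 1
  simp only [spikedCov, Matrix.add_mulVec, Matrix.sub_mulVec, Matrix.smul_mulVec,
    Matrix.vecMulVec_mulVec, hP, hQ, hI', hD]
  ext i
  simp only [one_div, Pi.add_apply, Pi.sub_apply, Pi.smul_apply, MulOpposite.op_zero, zero_smul,
    Pi.zero_apply, MulOpposite.smul_eq_mul_unop, MulOpposite.unop_op, smul_eq_mul, mul_zero]
  field_simp
  simp

theorem generalModel_spikedCov (hs : 0 < s) (hm : 0 < m) (hI : I.card = s) (hP : P.card = m)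
    (hQ : Q.card = m) (hIP : Disjoint I P) (hIQ : Disjoint I Q) (hPQ : Disjoint P Q) :
    GeneralModel s (spike I s) (spikedCov I P Q s m) := by
  have hb := quadForm_spikedCov_bounds hs hm hI hP hQ hIP hIQ hPQ
  have hpsd : (spikedCov I P Q s m).PosSemidef :=
    Matrix.PosSemidef.of_dotProduct_mulVec_nonneg spikedCov_isHermitian fun x => by
      simpa using (hb x).1
  have hv := spike_dotProduct_self (I := I) hs hI
  have hSv := spikedCov_mulVec_spike (m := m) hs hI hIP hIQ
  have hlam : lam hpsd.isHermitian 1 = 1 := by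
    refine le_antisymm (lam_one_le _ zero_le_one fun w => by simpa using (hb w).2.1) ?_
    have := quadForm_le_lam_one hpsd.isHermitian (spike I s)
    rwa [hSv, hv, mul_one] at this
  refine ⟨hpsd, hv, (nnz_spike hs hI).le, ⟨?_, ?_⟩, ?_, ?_⟩
  · intro h
    rw [h] at hv
    simp at hv
  · rw [hlam, one_smul, hSv]
  · rw [hlam]; exact one_pos
  · rw [hlam, mul_one]
    refine lam_two_le _ (by norm_num) (spike I s) fun w hw => (hb w).2.2 ?_
    rw [dotProduct_spike] at hw
    refine (mul_eq_zero.1 hw).resolve_left ?_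
    have hs' : (0 : ℝ) < s := by exact_mod_cast hs
    exact (inv_pos.2 (Real.sqrt_pos.2 hs')).ne'

end

/-! ### Thresholding a matrix entrywise close to the spiked covariance. -/

theorem thresh_of_abs_lt {τ c : ℝ} (h : |c| < τ) : thresh τ c = 0 := if_neg (not_le.2 h)

theorem thresh_of_le_abs {τ c : ℝ} (h : τ ≤ |c|) : thresh τ c = c := if_pos h

/-- A top eigenvector vanishes on every invariant set of coordinates on which the row sums of
absolute values are smaller than the top eigenvalue. -/
theorem eigenvector_eq_zero_of_row_sums_lt {d : ℕ} {T : Matrix (Fin d) (Fin d) ℝ}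
    (I : Finset (Fin d)) {r l : ℝ} (hrl : r < l) (hzero : ∀ i ∈ I, ∀ j, j ∉ I → T i j = 0)
    (hrow : ∀ i ∈ I, ∑ j ∈ I, |T i j| ≤ r) {u : Fin d → ℝ} (hu : T *ᵥ u = l • u) :
    ∀ i ∈ I, u i = 0 := by
  by_contra! hne
  obtain ⟨i₀, hi₀, hui₀⟩ := hne
  -- The Gershgorin argument: read the eigenvalue equation at the coordinate of `I` where `|u|` is
  -- largest.
  obtain ⟨i, hi, hmax⟩ := I.exists_max_image (fun i => |u i|) ⟨i₀, hi₀⟩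
  have hpos : 0 < |u i| := (abs_pos.2 hui₀).trans_le (hmax i₀ hi₀)
  have heq : ∑ j ∈ I, T i j * u j = l * u i := by
    have := congrFun hu i
    rw [Pi.smul_apply, smul_eq_mul] at this
    rw [← this, Matrix.mulVec, dotProduct]
    exact Finset.sum_subset (Finset.subset_univ I) fun j _ hj => by rw [hzero i hi j hj, zero_mul]
  have h1 : l * |u i| ≤ r * |u i| :=
    calc l * |u i| ≤ |l| * |u i| := mul_le_mul_of_nonneg_right (le_abs_self l) hpos.le
      _ = |∑ j ∈ I, T i j * u j| := by rw [heq, abs_mul]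
      _ ≤ ∑ j ∈ I, |T i j| * |u i| := by
          refine (Finset.abs_sum_le_sum_abs _ _).trans (Finset.sum_le_sum fun j hj => ?_)
          rw [abs_mul]
          exact mul_le_mul_of_nonneg_left (hmax j hj) (abs_nonneg _)
      _ = (∑ j ∈ I, |T i j|) * |u i| := by rw [Finset.sum_mul]
      _ ≤ r * |u i| := mul_le_mul_of_nonneg_right (hrow i hi) hpos.le
  exact absurd (le_of_mul_le_mul_right h1 hpos) (not_le.2 hrl)

section

variable {d : ℕ} {I P Q : Finset (Fin d)} {s m : ℕ} {τ : ℝ} {M : Matrix (Fin d) (Fin d) ℝ}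

/-- The window for `mτ` separates the two kinds of entries: `0.3/m ≤ (6/7)τ` stays below `τ` after
an error `τ/20`, and `0.45/m ≥ (9/8)τ` stays above it. A row then keeps its diagonal entry, at least
`3/4 - 3/70 - τ/20`, and `m` cross entries of total at least `0.45 - mτ/20`. -/
theorem sum_thresh_row_block_ge (hm : 7 ≤ m) (hτ : 0 < τ) (hmτ : 0.35 ≤ m * τ)
    (hmτ' : m * τ ≤ 0.4) (hτc : τ ≤ 1 / 20) (hQ : Q.card = m) (hIP : Disjoint I P)
    (hPQ : Disjoint P Q) (hM : ∀ i j, |M i j - spikedCov I P Q s m i j| ≤ τ / 20) {i : Fin d}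
    (hi : i ∈ P) : 1.1 ≤ ∑ j ∈ P ∪ Q, thresh τ (M i j) := by
  have hm' : (7 : ℝ) ≤ m := by exact_mod_cast hm
  have hm0 : (0 : ℝ) < m := by linarith
  have hiI := Finset.disjoint_right.1 hIP hi
  have hiQ := Finset.disjoint_left.1 hPQ hi
  have inv_le : 1 / (m : ℝ) ≤ 1 / 7 := one_div_le_one_div_of_le (by norm_num) hm'
  have lo : 3 / 10 / (m : ℝ) ≤ 6 / 7 * τ := by
    rw [div_le_iff₀ hm0]; linarith
  have hi' : 9 / 8 * τ ≤ 9 / 20 / (m : ℝ) := by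
    rw [le_div_iff₀ hm0]; linarith
  have hoff : ∀ j ∈ P, j ≠ i → thresh τ (M i j) = 0 := by
    intro j hj hji
    have h := hM i j
    rw [spikedCov_apply, indVec_of_mem hi, indVec_of_mem hj, indVec_of_notMem hiI,
      indVec_of_notMem hiQ, indVec_of_notMem (Finset.disjoint_left.1 hPQ hj),
      if_neg (Ne.symm hji)] at h
    have hn : 0 ≤ 3 / 10 / (m : ℝ) := by positivity
    rw [abs_le] at h
    refine thresh_of_abs_lt (abs_lt.2 ⟨?_, ?_⟩) <;> linarith [h.1, h.2]
  have hdiag : 3 / 4 - 3 / 70 - τ / 20 ≤ thresh τ (M i i) := by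
    have h := hM i i
    rw [spikedCov_apply, indVec_of_mem hi, indVec_of_notMem hiI, indVec_of_notMem hiQ,
      if_pos rfl, abs_le] at h
    have e : 3 / 10 / (m : ℝ) = 3 / 10 * (1 / (m : ℝ)) := by ring
    have h1 : 3 / 4 - 3 / 70 - τ / 20 ≤ M i i := by linarith [h.1]
    rwa [thresh_of_le_abs (le_trans (by linarith) (le_abs_self _))]
  have hcross : ∀ j ∈ Q, 9 / 20 / (m : ℝ) - τ / 20 ≤ thresh τ (M i j) := by
    intro j hj
    have hjP := Finset.disjoint_right.1 hPQ hj
    have hji : i ≠ j := fun h => hiQ (h ▸ hj)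
    have h := hM i j
    rw [spikedCov_apply, indVec_of_mem hi, indVec_of_mem hj, indVec_of_notMem hiI,
      indVec_of_notMem hiQ, indVec_of_notMem hjP, if_neg hji, abs_le] at h
    have h1 : 9 / 20 / (m : ℝ) - τ / 20 ≤ M i j := by linarith [h.1]
    rwa [thresh_of_le_abs (le_trans (by linarith) (le_abs_self _))]
  rw [Finset.sum_union hPQ, Finset.sum_eq_single_of_mem i hi hoff]
  have hs := Finset.card_nsmul_le_sum Q _ _ hcross
  rw [hQ, nsmul_eq_mul, mul_sub, mul_div_cancel₀ _ hm0.ne'] at hs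
  linarith

theorem lam_one_thresh_ge (hm : 7 ≤ m) (hτ : 0 < τ) (hmτ : 0.35 ≤ m * τ)
    (hmτ' : m * τ ≤ 0.4) (hτc : τ ≤ 1 / 20) (hP : P.card = m) (hQ : Q.card = m)
    (hIP : Disjoint I P) (hIQ : Disjoint I Q) (hPQ : Disjoint P Q)
    (hM : ∀ i j, |M i j - spikedCov I P Q s m i j| ≤ τ / 20)
    (hT : (M.map (thresh τ)).IsHermitian) : 1.1 ≤ lam hT 1 := by
  have hrow : ∀ i ∈ P ∪ Q, 1.1 ≤ ∑ j ∈ P ∪ Q, thresh τ (M i j) := by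
    intro i hi
    rcases Finset.mem_union.1 hi with hi | hi
    · exact sum_thresh_row_block_ge hm hτ hmτ hmτ' hτc hQ hIP hPQ hM hi
    · rw [Finset.union_comm]
      rw [spikedCov_comm] at hM
      exact sum_thresh_row_block_ge hm hτ hmτ hmτ' hτc hP hIQ hPQ.symm hM hi
  -- The Rayleigh quotient of the indicator of `P ∪ Q` is the average row sum of the block.
  have hR := quadForm_le_lam_one hT (indVec (P ∪ Q))
  rw [indVec_dotProduct, indVec_dotProduct, sum_indVec, Finset.inter_self] at hR
  have hsum : 1.1 * ((P ∪ Q).card : ℝ) ≤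
      ∑ i ∈ P ∪ Q, (M.map (thresh τ) *ᵥ indVec (P ∪ Q)) i := by
    have := Finset.card_nsmul_le_sum (P ∪ Q)
      (fun i => (M.map (thresh τ) *ᵥ indVec (P ∪ Q)) i) 1.1 fun i hi => by
        rw [Matrix.mulVec, dotProduct_indVec]
        exact hrow i hi
    rwa [nsmul_eq_mul, mul_comm] at this
  have hcard : (0 : ℝ) < (P ∪ Q).card := by
    rw [Finset.card_union_of_disjoint hPQ, hP, hQ]
    exact_mod_cast (by omega : 0 < m + m)
  exact le_of_mul_le_mul_right (hsum.trans hR) hcard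

/-- An entry that survives satisfies `τ ≤ 1/s + τ/20`, so its error `τ/20` is at most `(1/19)/s`,
and its size is at most `(20/19)/s < 1.06/s`. No comparison between `1/s` and `τ` is needed: entries
that are removed only help. -/
theorem sum_abs_thresh_row_spike_le (hs : 0 < s) (hI : I.card = s)
    (hIP : Disjoint I P) (hIQ : Disjoint I Q)
    (hM : ∀ i j, |M i j - spikedCov I P Q s m i j| ≤ τ / 20) {i : Fin d} (hi : i ∈ I) :
    ∑ j ∈ I, |thresh τ (M i j)| ≤ 1.06 := by
  have hs' : (0 : ℝ) < s := by exact_mod_cast hs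
  have hent : ∀ j ∈ I, |thresh τ (M i j)| ≤ 1.06 / (s : ℝ) := by
    intro j hj
    have h := hM i j
    rw [spikedCov_apply, indVec_of_mem hi, indVec_of_mem hj,
      indVec_of_notMem (Finset.disjoint_left.1 hIP hi),
      indVec_of_notMem (Finset.disjoint_left.1 hIQ hi)] at h
    simp only [mul_one, add_zero, zero_mul, ite_self, mul_zero, sub_zero] at h
    rcases lt_or_ge |M i j| τ with hlt | hge
    · rw [thresh_of_abs_lt hlt, abs_zero]; positivity
    · rw [thresh_of_le_abs hge]
      have h0 : 0 < 1 / (s : ℝ) := by positivity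
      have h1 : |M i j| ≤ 1 / (s : ℝ) + τ / 20 := by
        have := abs_sub_abs_le_abs_sub (M i j) (1 / (s : ℝ))
        rw [abs_of_pos h0] at this
        linarith
      have e : 1.06 / (s : ℝ) = 1.06 * (1 / (s : ℝ)) := by ring
      rw [e]
      linarith
  have := Finset.sum_le_card_nsmul I _ _ hent
  rwa [hI, nsmul_eq_mul, mul_div_cancel₀ _ hs'.ne'] at this

theorem thresh_eq_zero_of_mem_spike (hτ : 0 < τ) (hIP : Disjoint I P) (hIQ : Disjoint I Q)
    (hM : ∀ i j, |M i j - spikedCov I P Q s m i j| ≤ τ / 20) {i j : Fin d} (hi : i ∈ I)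
    (hj : j ∉ I) : thresh τ (M i j) = 0 := by
  have h := hM i j
  rw [spikedCov_apply, indVec_of_mem hi, indVec_of_notMem hj,
    indVec_of_notMem (Finset.disjoint_left.1 hIP hi),
    indVec_of_notMem (Finset.disjoint_left.1 hIQ hi)] at h
  simp only [mul_zero, add_zero, zero_mul, ite_self, sub_zero] at h
  exact thresh_of_abs_lt (by linarith)

theorem sinSqAngle_eq_one_of_close (hs : 0 < s) (hm : 7 ≤ m) (hτ : 0 < τ)
    (hmτ : 0.35 ≤ m * τ) (hmτ' : m * τ ≤ 0.4) (hτc : τ ≤ 1 / 20) (hI : I.card = s)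
    (hP : P.card = m) (hQ : Q.card = m) (hIP : Disjoint I P) (hIQ : Disjoint I Q)
    (hPQ : Disjoint P Q) (hM : ∀ i j, |M i j - spikedCov I P Q s m i j| ≤ τ / 20)
    (hT : (M.map (thresh τ)).IsHermitian) {u : Fin d → ℝ} (hu : IsTopEigenvector hT u) :
    sinSqAngle u (spike I s) = 1 := by
  have hlam := lam_one_thresh_ge hm hτ hmτ hmτ' hτc hP hQ hIP hIQ hPQ hM hT
  have hzero := eigenvector_eq_zero_of_row_sums_lt I (r := 1.06)
    (lt_of_lt_of_le (by norm_num) hlam)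
    (fun i hi j hj => thresh_eq_zero_of_mem_spike hτ hIP hIQ hM hi hj)
    (fun i hi => sum_abs_thresh_row_spike_le hs hI hIP hIQ hM hi) hu.2
  rw [sinSqAngle, dotProduct_spike, Finset.sum_eq_zero hzero]
  simp

end

/-! ### Exponential moments of products of sub-Gaussian variables. -/

theorem exp_le_one_add_add_sq_mul_exp_abs (y : ℝ) :
    Real.exp y ≤ 1 + y + y ^ 2 * Real.exp |y| := by
  have h := Complex.norm_exp_sub_sum_le_norm_mul_exp (y : ℂ) 2
  simp only [Finset.sum_range_succ, Finset.sum_range_zero, zero_add, pow_zero, Nat.factorial_zero,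
    Nat.cast_one, div_one, pow_one, Nat.factorial_one, Complex.norm_real, Real.norm_eq_abs,
    sq_abs] at h
  have h2 : ‖Complex.exp (y : ℂ) - (1 + (y : ℂ))‖ = |Real.exp y - (1 + y)| := by
    rw [← Real.norm_eq_abs, ← Complex.norm_real]
    push_cast
    rfl
  rw [h2] at h
  linarith [le_abs_self (Real.exp y - (1 + y))]

/-- The weight `exp (g²/2)` turns the density of variance 1/2 into `√2` times the standard normal
density. -/
theorem lintegral_exp_sq_half_gaussianReal :
    ∫⁻ g, ENNReal.ofReal (Real.exp (g ^ 2 / 2)) ∂(gaussianReal 0 (1 / 2))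
      = ENNReal.ofReal (Real.sqrt 2) := by
  have hpos : (0 : ℝ) ≤ Real.sqrt 2 := Real.sqrt_nonneg 2
  rw [gaussianReal_of_var_ne_zero _ (by norm_num : (1 / 2 : NNReal) ≠ 0),
    lintegral_withDensity_eq_lintegral_mul _ (measurable_gaussianPDF _ _) (by fun_prop)]
  have key : ∀ g : ℝ, (gaussianPDF 0 (1 / 2) * fun g => ENNReal.ofReal (Real.exp (g ^ 2 / 2))) g
      = ENNReal.ofReal (Real.sqrt 2) * gaussianPDF 0 1 g := by
    intro g
    rw [Pi.mul_apply, gaussianPDF, gaussianPDF, ← ENNReal.ofReal_mul (gaussianPDFReal_nonneg _ _ _),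
      ← ENNReal.ofReal_mul hpos]
    congr 1
    simp only [gaussianPDFReal]
    have e1 : Real.sqrt (2 * Real.pi * ((1 / 2 : NNReal) : ℝ)) = Real.sqrt Real.pi := by
      congr 1; push_cast; ring
    have e2 : Real.sqrt (2 * Real.pi * ((1 : NNReal) : ℝ)) = Real.sqrt 2 * Real.sqrt Real.pi := by
      rw [← Real.sqrt_mul (by norm_num)]; simp
    rw [e1, e2, mul_assoc, ← Real.exp_add]
    have e3 : -(g - 0) ^ 2 / (2 * ((1 / 2 : NNReal) : ℝ)) + g ^ 2 / 2
        = -(g - 0) ^ 2 / (2 * ((1 : NNReal) : ℝ)) := by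
      push_cast; ring
    rw [e3, mul_inv, ← mul_assoc, ← mul_assoc, mul_inv_cancel₀ (by positivity), one_mul]
  simp_rw [key]
  rw [lintegral_const_mul _ (measurable_gaussianPDF _ _),
    lintegral_gaussianPDF_eq_one _ one_ne_zero, mul_one]

section

variable {Ω : Type*} [MeasurableSpace Ω] {μ : Measure Ω} [IsProbabilityMeasure μ] {X Y : Ω → ℝ}

/-- The exponential moment of the square of a sub-Gaussian variable, by averaging its moment
generating function against a Gaussian weight. -/
theorem integral_exp_sq_div_four_le (hX : HasSubgaussianMGF X 1 μ) :
    Integrable (fun ω => Real.exp (X ω ^ 2 / 4)) μ ∧ ∫ ω, Real.exp (X ω ^ 2 / 4) ∂μ ≤ 2 := by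
  have hXm : AEMeasurable X μ := hX.aemeasurable
  have hmeas : AEStronglyMeasurable (fun ω => Real.exp (X ω ^ 2 / 4)) μ := by
    have : AEMeasurable (fun ω => Real.exp (X ω ^ 2 / 4)) μ := by fun_prop
    exact this.aestronglyMeasurable
  have hbound : ∫⁻ ω, ENNReal.ofReal (Real.exp (X ω ^ 2 / 4)) ∂μ ≤
      ENNReal.ofReal (Real.sqrt 2) := by
    -- For `g` Gaussian of variance 1/2, `exp (x²/4)` is the mean of `exp (g x)`. Tonelli then lets
    -- the bound on the moment generating function of `X` be applied for each fixed `g`;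
    -- integrability is a consequence, not an input.
    have h1 : ∀ x : ℝ, ENNReal.ofReal (Real.exp (x ^ 2 / 4))
        = ∫⁻ g, ENNReal.ofReal (Real.exp (g * x)) ∂(gaussianReal 0 (1 / 2)) := by
      intro x
      have hi : Integrable (fun g : ℝ => Real.exp (g * x)) (gaussianReal 0 (1 / 2)) := by
        simp_rw [mul_comm _ x]
        exact integrable_exp_mul_gaussianReal x
      rw [← ofReal_integral_eq_lintegral_ofReal hi (ae_of_all _ fun _ => (Real.exp_pos _).le)]
      have := congrFun (mgf_fun_id_gaussianReal (μ := 0) (v := 1 / 2)) x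
      simp_rw [mgf, mul_comm x] at this
      rw [this]
      congr 2
      push_cast
      ring
    simp_rw [h1]
    rw [lintegral_lintegral_swap]
    · rw [← lintegral_exp_sq_half_gaussianReal]
      refine lintegral_mono fun g => ?_
      rw [← ofReal_integral_eq_lintegral_ofReal (hX.integrable_exp_mul g)
        (ae_of_all _ fun _ => (Real.exp_pos _).le)]
      refine ENNReal.ofReal_le_ofReal ?_
      simpa [mgf] using hX.mgf_le g
    · have : AEMeasurable (fun p : Ω × ℝ => X p.1) (μ.prod (gaussianReal 0 (1 / 2))) :=
        hXm.comp_quasiMeasurePreserving Measure.quasiMeasurePreserving_fst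
      simp only [Function.uncurry_def]
      fun_prop
  have hint : Integrable (fun ω => Real.exp (X ω ^ 2 / 4)) μ := by
    refine ⟨hmeas, ?_⟩
    rw [hasFiniteIntegral_iff_ofReal (ae_of_all _ fun _ => (Real.exp_pos _).le)]
    exact hbound.trans_lt ENNReal.ofReal_lt_top
  refine ⟨hint, ?_⟩
  rw [← ofReal_integral_eq_lintegral_ofReal hint (ae_of_all _ fun _ => (Real.exp_pos _).le),
    ENNReal.ofReal_le_ofReal_iff (Real.sqrt_nonneg 2)] at hbound
  exact hbound.trans (Real.sqrt_le_iff.2 ⟨by norm_num, by norm_num⟩)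

/-- From `1 + t E X ≤ E exp (tX) ≤ exp (t²/2) ≤ 1 + t²` one gets `E X ≤ t` for every small `t > 0`.
With the same bound for `-X` the mean is 0, so the uncentred second moments averaged by the sample
covariance are the covariances. -/
theorem integral_nonpos_of_hasSubgaussianMGF (hX : HasSubgaussianMGF X 1 μ) : ∫ ω, X ω ∂μ ≤ 0 := by
  refine le_of_forall_pos_le_add fun ε hε => ?_
  set t : ℝ := min 1 ε with ht
  have ht0 : 0 < t := lt_min one_pos hε
  have ht1 : t ≤ 1 := min_le_left _ _
  have hXi : Integrable X μ := hX.integrable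
  have h1 : 1 + t * ∫ ω, X ω ∂μ ≤ Real.exp (t ^ 2 / 2) := by
    have hle : ∫ ω, (1 + t * X ω) ∂μ ≤ mgf X μ t :=
      integral_mono ((integrable_const _).add (hXi.const_mul t)) (hX.integrable_exp_mul t)
        fun ω => by rw [add_comm]; exact Real.add_one_le_exp _
    rw [integral_add (integrable_const _) (hXi.const_mul t), integral_const_mul] at hle
    simpa using hle.trans (hX.mgf_le t)
  have h2 : Real.exp (t ^ 2 / 2) ≤ 1 + t ^ 2 := by
    have h3 : |t ^ 2 / 2| ≤ 1 := by rw [abs_of_nonneg (by positivity)]; nlinarith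
    have h4 := (abs_le.1 (Real.abs_exp_sub_one_le h3)).2
    rw [abs_of_nonneg (by positivity : (0 : ℝ) ≤ t ^ 2 / 2)] at h4
    linarith
  have h5 : t * ∫ ω, X ω ∂μ ≤ t * t := by nlinarith
  have := le_of_mul_le_mul_left h5 ht0
  linarith [min_le_right 1 ε]

theorem integral_eq_zero_of_hasSubgaussianMGF (hX : HasSubgaussianMGF X 1 μ) :
    ∫ ω, X ω ∂μ = 0 := by
  have h := integral_nonpos_of_hasSubgaussianMGF hX.neg
  simp only [Pi.neg_apply, integral_neg] at h
  exact le_antisymm (integral_nonpos_of_hasSubgaussianMGF hX) (by linarith)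

theorem integral_exp_abs_mul_div_four_le (hX : HasSubgaussianMGF X 1 μ)
    (hY : HasSubgaussianMGF Y 1 μ) :
    Integrable (fun ω => Real.exp (|X ω * Y ω| / 4)) μ ∧
      ∫ ω, Real.exp (|X ω * Y ω| / 4) ∂μ ≤ 2 := by
  have hXm : AEMeasurable X μ := hX.aemeasurable
  have hYm : AEMeasurable Y μ := hY.aemeasurable
  obtain ⟨iX, bX⟩ := integral_exp_sq_div_four_le hX
  obtain ⟨iY, bY⟩ := integral_exp_sq_div_four_le hY
  have hpt : ∀ ω, Real.exp (|X ω * Y ω| / 4) ≤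
      1 / 2 * Real.exp (X ω ^ 2 / 4) + 1 / 2 * Real.exp (Y ω ^ 2 / 4) := by
    intro ω
    have h1 : Real.exp (|X ω * Y ω| / 4) ≤ Real.exp (X ω ^ 2 / 8) * Real.exp (Y ω ^ 2 / 8) := by
      rw [← Real.exp_add, abs_mul]
      refine Real.exp_le_exp.2 ?_
      nlinarith [sq_nonneg (|X ω| - |Y ω|), sq_abs (X ω), sq_abs (Y ω)]
    have h2 : Real.exp (X ω ^ 2 / 4) = Real.exp (X ω ^ 2 / 8) ^ 2 := by
      rw [← Real.exp_nat_mul]; congr 1; push_cast; ring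
    have h3 : Real.exp (Y ω ^ 2 / 4) = Real.exp (Y ω ^ 2 / 8) ^ 2 := by
      rw [← Real.exp_nat_mul]; congr 1; push_cast; ring
    rw [h2, h3]
    nlinarith [sq_nonneg (Real.exp (X ω ^ 2 / 8) - Real.exp (Y ω ^ 2 / 8))]
  have isum : Integrable (fun ω =>
      1 / 2 * Real.exp (X ω ^ 2 / 4) + 1 / 2 * Real.exp (Y ω ^ 2 / 4)) μ :=
    (iX.const_mul _).add (iY.const_mul _)
  have hint : Integrable (fun ω => Real.exp (|X ω * Y ω| / 4)) μ := by
    refine isum.mono' ?_ (ae_of_all _ fun ω => ?_)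
    · have : AEMeasurable (fun ω => Real.exp (|X ω * Y ω| / 4)) μ := by fun_prop
      exact this.aestronglyMeasurable
    · rw [Real.norm_of_nonneg (Real.exp_pos _).le]; exact hpt ω
  refine ⟨hint, (integral_mono hint isum hpt).trans ?_⟩
  rw [integral_add (iX.const_mul _) (iY.const_mul _), integral_const_mul, integral_const_mul]
  linarith

/-- Bernstein-type bound: a centred product of two sub-Gaussian variables is sub-exponential. -/
theorem mgf_mul_sub_integral_le (hX : HasSubgaussianMGF X 1 μ) (hY : HasSubgaussianMGF Y 1 μ)
    {t : ℝ} (ht : |t| ≤ 1 / 8) :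
    Integrable (fun ω => Real.exp (t * (X ω * Y ω - ∫ ω, X ω * Y ω ∂μ))) μ ∧
      mgf (fun ω => X ω * Y ω - ∫ ω, X ω * Y ω ∂μ) μ t ≤ Real.exp (2500 * t ^ 2) := by
  have hXm : AEMeasurable X μ := hX.aemeasurable
  have hYm : AEMeasurable Y μ := hY.aemeasurable
  obtain ⟨iE, bE⟩ := integral_exp_abs_mul_div_four_le hX hY
  have hpt : ∀ ω, |X ω * Y ω| ≤ 4 * Real.exp (|X ω * Y ω| / 4) := fun ω => by
    linarith [Real.add_one_le_exp (|X ω * Y ω| / 4)]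
  have hXY : Integrable (fun ω => X ω * Y ω) μ :=
    (iE.const_mul 4).mono' (by
      have : AEMeasurable (fun ω => X ω * Y ω) μ := by fun_prop
      exact this.aestronglyMeasurable) (ae_of_all _ hpt)
  set a := ∫ ω, X ω * Y ω ∂μ with ha
  have ha8 : |a| ≤ 8 := by
    refine (abs_integral_le_integral_abs).trans ?_
    refine (integral_mono hXY.abs (iE.const_mul 4) hpt).trans ?_
    rw [integral_const_mul]; linarith
  have hexp2 : Real.exp 2 ≤ 9 := by
    have h := Real.exp_one_lt_d9
    have h2 : Real.exp 2 = Real.exp 1 ^ 2 := by rw [← Real.exp_nat_mul]; norm_num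
    rw [h2]
    nlinarith [Real.exp_pos 1]
  have hdom : ∀ ω, Real.exp (|X ω * Y ω - a| / 4) ≤ 9 * Real.exp (|X ω * Y ω| / 4) := by
    intro ω
    have h1 : |X ω * Y ω - a| / 4 ≤ 2 + |X ω * Y ω| / 4 := by
      linarith [abs_sub (X ω * Y ω) a]
    refine (Real.exp_le_exp.2 h1).trans ?_
    rw [Real.exp_add]
    exact mul_le_mul_of_nonneg_right hexp2 (Real.exp_pos _).le
  -- Of the available exponent `|z|/4`, half dominates `exp |tz|` and half absorbs `z²` at the cost
  -- of a factor 128. Recentring by `|a| ≤ 8` costs `exp 2 ≤ 9`, and `128 * 9 = 1152`. The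
  -- expectation bound 2 then gives `2304 ≤ 2500`.
  have hup : ∀ ω, Real.exp (t * (X ω * Y ω - a)) ≤
      1 + t * (X ω * Y ω - a) + t ^ 2 * (1152 * Real.exp (|X ω * Y ω| / 4)) := by
    intro ω
    set z := X ω * Y ω - a with hz
    refine (exp_le_one_add_add_sq_mul_exp_abs (t * z)).trans ?_
    have h1 : Real.exp |t * z| ≤ Real.exp (|z| / 8) := by
      rw [abs_mul]
      refine Real.exp_le_exp.2 ?_
      linarith [mul_le_mul_of_nonneg_right ht (abs_nonneg z)]
    have h2 : z ^ 2 ≤ 128 * Real.exp (|z| / 8) := by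
      have := Real.quadratic_le_exp_of_nonneg (x := |z| / 8) (by positivity)
      have e : (|z| / 8) ^ 2 = z ^ 2 / 64 := by rw [div_pow, sq_abs]; norm_num
      rw [e] at this
      linarith [abs_nonneg z]
    have h3 : Real.exp (|z| / 8) * Real.exp (|z| / 8) = Real.exp (|z| / 4) := by
      rw [← Real.exp_add]; congr 1; ring
    have h4 : z ^ 2 * Real.exp |t * z| ≤ 1152 * Real.exp (|X ω * Y ω| / 4) :=
      calc z ^ 2 * Real.exp |t * z| ≤ (128 * Real.exp (|z| / 8)) * Real.exp (|z| / 8) :=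
            mul_le_mul h2 h1 (Real.exp_pos _).le (by positivity)
        _ = 128 * Real.exp (|z| / 4) := by rw [mul_assoc, h3]
        _ ≤ _ := by linarith [hdom ω]
    have h5 := mul_le_mul_of_nonneg_left h4 (sq_nonneg t)
    rw [mul_pow, mul_assoc]
    linarith
  have hlin : Integrable (fun ω => 1 + t * (X ω * Y ω - a)) μ :=
    (integrable_const _).add ((hXY.sub (integrable_const _)).const_mul t)
  have hquad : Integrable (fun ω => t ^ 2 * (1152 * Real.exp (|X ω * Y ω| / 4))) μ :=
    (iE.const_mul _).const_mul _
  have hint : Integrable (fun ω => Real.exp (t * (X ω * Y ω - a))) μ := by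
    refine (hlin.add hquad).mono' ?_ (ae_of_all _ fun ω => ?_)
    · have : AEMeasurable (fun ω => Real.exp (t * (X ω * Y ω - a))) μ := by fun_prop
      exact this.aestronglyMeasurable
    · rw [Real.norm_of_nonneg (Real.exp_pos _).le]; exact hup ω
  refine ⟨hint, ?_⟩
  calc mgf (fun ω => X ω * Y ω - a) μ t
      ≤ ∫ ω, (1 + t * (X ω * Y ω - a) + t ^ 2 * (1152 * Real.exp (|X ω * Y ω| / 4))) ∂μ :=
        integral_mono hint (hlin.add hquad) hup
    _ = 1 + t ^ 2 * (1152 * ∫ ω, Real.exp (|X ω * Y ω| / 4) ∂μ) := by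
        have hz : Integrable (fun ω => X ω * Y ω - a) μ := hXY.sub (integrable_const _)
        rw [integral_add hlin hquad, integral_add (integrable_const _) (hz.const_mul t),
          integral_const_mul, integral_const_mul, integral_const_mul,
          integral_sub hXY (integrable_const _)]
        simp [← ha]
    _ ≤ 1 + 2500 * t ^ 2 := by nlinarith [sq_nonneg t]
    _ ≤ Real.exp (2500 * t ^ 2) := by
        rw [add_comm]; exact Real.add_one_le_exp _

end

/-! ### Concentration of sums of independent copies. -/

/-- Chernoff bound for sums of independent copies of a sub-exponential function. -/
theorem pi_real_le_sum_le {Ω : Type*} [MeasurableSpace Ω] {D : Measure Ω} [IsProbabilityMeasure D]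
    {f : Ω → ℝ} (hf : Measurable f)
    (hmgf : ∀ t : ℝ, |t| ≤ 1 / 8 →
      Integrable (fun ω => Real.exp (t * f ω)) D ∧ mgf f D t ≤ Real.exp (2500 * t ^ 2))
    (n : ℕ) {η : ℝ} (hη : 0 ≤ η) (hη1 : η ≤ 1) :
    (Measure.pi fun _ : Fin n => D).real {x | n * η ≤ ∑ k, f (x k)} ≤
      Real.exp (-(n * η ^ 2 / 10000)) := by
  -- The minimiser of `2500 t² - tη`, with minimum `-η²/10000`; it lies in the allowed range because
  -- `η ≤ 1`.
  set t : ℝ := η / 5000 with ht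
  have ht0 : 0 ≤ t := by positivity
  have ht8 : |t| ≤ 1 / 8 := by rw [abs_of_nonneg ht0]; linarith
  obtain ⟨hi, hb⟩ := hmgf t ht8
  have hind : iIndepFun (fun (k : Fin n) (x : Fin n → Ω) => f (x k))
      (Measure.pi fun _ : Fin n => D) := iIndepFun_pi fun _ => hf.aemeasurable
  have hmeas : ∀ k : Fin n, Measurable fun x : Fin n → Ω => f (x k) := fun k => by fun_prop
  have hmp : ∀ k : Fin n, MeasurePreserving (Function.eval k)
      (Measure.pi fun _ : Fin n => D) D := fun k => measurePreserving_eval _ k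
  have hik : ∀ k : Fin n, Integrable (fun x : Fin n → Ω => Real.exp (t * f (x k)))
      (Measure.pi fun _ : Fin n => D) := fun k =>
    (hmp k).integrable_comp_of_integrable hi
  have hmk : ∀ k : Fin n, mgf (fun x : Fin n → Ω => f (x k))
      (Measure.pi fun _ : Fin n => D) t = mgf f D t := by
    intro k
    have hg : AEStronglyMeasurable (fun ω => Real.exp (t * f ω))
        (Measure.map (Function.eval k) (Measure.pi fun _ : Fin n => D)) := by
      rw [(hmp k).map_eq]; exact hi.aestronglyMeasurable
    have := integral_map (hmp k).measurable.aemeasurable hg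
    rw [(hmp k).map_eq] at this
    exact this.symm
  have hmgfsum := hind.mgf_sum (t := t) hmeas Finset.univ
  have hint := hind.integrable_exp_mul_sum (t := t) hmeas (s := Finset.univ) fun k _ => hik k
  have hch := measure_ge_le_exp_mul_mgf ((n : ℝ) * η) ht0 hint
  rw [hmgfsum] at hch
  simp only [hmk, Finset.prod_const, Finset.card_univ, Fintype.card_fin, Finset.sum_apply] at hch
  refine hch.trans ?_
  calc Real.exp (-t * (n * η)) * mgf f D t ^ n
      ≤ Real.exp (-t * (n * η)) * Real.exp (2500 * t ^ 2) ^ n := by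
        gcongr
        exact mgf_nonneg
    _ = Real.exp (-(n * η ^ 2 / 10000)) := by
        rw [← Real.exp_nat_mul, ← Real.exp_add]
        congr 1
        rw [ht]
        ring

theorem pi_real_le_abs_sum_le {Ω : Type*} [MeasurableSpace Ω] {D : Measure Ω}
    [IsProbabilityMeasure D] {f : Ω → ℝ} (hf : Measurable f)
    (hmgf : ∀ t : ℝ, |t| ≤ 1 / 8 →
      Integrable (fun ω => Real.exp (t * f ω)) D ∧ mgf f D t ≤ Real.exp (2500 * t ^ 2))
    (n : ℕ) {η : ℝ} (hη : 0 ≤ η) (hη1 : η ≤ 1) :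
    (Measure.pi fun _ : Fin n => D).real {x | n * η ≤ |∑ k, f (x k)|} ≤
      2 * Real.exp (-(n * η ^ 2 / 10000)) := by
  have h1 := pi_real_le_sum_le hf hmgf n hη hη1
  have h2 := pi_real_le_sum_le (f := fun ω => -f ω) hf.neg (fun t ht => by
    obtain ⟨a, b⟩ := hmgf (-t) (by rwa [abs_neg])
    have e : (fun ω => -f ω) = -f := rfl
    refine ⟨by simpa using a, ?_⟩
    rw [e, mgf_neg]
    simpa using b) n hη hη1
  have hsub : {x : Fin n → Ω | n * η ≤ |∑ k, f (x k)|} ⊆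
      {x | n * η ≤ ∑ k, f (x k)} ∪ {x | n * η ≤ ∑ k, -f (x k)} := by
    intro x hx
    simpa [Finset.sum_neg_distrib, le_abs] using hx
  refine (measureReal_mono hsub).trans ((measureReal_union_le _ _).trans ?_)
  linarith

/-! ### Distributions with a given covariance, and their sample covariance. -/

/-- The centred Gaussian with covariance `S` works: its moment generating function at `u` is `exp
(uᵀSu / 2)`, and `S` is dominated by the identity. -/
theorem exists_subGaussian_of_quadForm_le {d : ℕ} {S : Matrix (Fin d) (Fin d) ℝ}
    (hS : S.PosSemidef) (hle : ∀ x : Fin d → ℝ, x ⬝ᵥ S *ᵥ x ≤ x ⬝ᵥ x) :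
    ∃ D : Measure (Fin d → ℝ), IsProbabilityMeasure D ∧ IsSubGaussian 1 D ∧
      HasCovarianceMatrix D S := by
  set G := multivariateGaussian (0 : EuclideanSpace ℝ (Fin d)) S with hG
  have hm : Measurable (WithLp.ofLp : EuclideanSpace ℝ (Fin d) → Fin d → ℝ) :=
    (MeasurableEquiv.toLp 2 (Fin d → ℝ)).symm.measurable
  refine ⟨G.map WithLp.ofLp, Measure.isProbabilityMeasure_map hm.aemeasurable, fun u => ?_,
    fun i j => ?_⟩
  · set L : StrongDual ℝ (EuclideanSpace ℝ (Fin d)) := innerSL ℝ (WithLp.toLp 2 u) with hL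
    have hLx : ∀ x : EuclideanSpace ℝ (Fin d), L x = u ⬝ᵥ WithLp.ofLp x := fun x => by
      rw [hL, innerSL_apply_apply, EuclideanSpace.inner_eq_star_dotProduct, star_trivial,
        dotProduct_comm]
    have hmean : ∫ x, L x ∂G = 0 := by
      rw [ContinuousLinearMap.integral_comp_comm _ IsGaussian.integrable_fun_id, hG,
        integral_id_multivariateGaussian, map_zero]
    have hvar : Var[L; G] = u ⬝ᵥ S *ᵥ u := by
      have := covarianceBilin_self (μ := G) IsGaussian.memLp_two_id (WithLp.toLp 2 u)
      rw [covarianceBilin_multivariateGaussian hS] at this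
      exact this.symm
    have hmap := IsGaussian.map_eq_gaussianReal (μ := G) L
    rw [hmean, hvar] at hmap
    have hnn : 0 ≤ u ⬝ᵥ S *ᵥ u := by simpa using hS.dotProduct_mulVec_nonneg u
    have hexp : Measurable fun x : Fin d → ℝ => Real.exp (u ⬝ᵥ x) := by
      unfold dotProduct; fun_prop
    rw [integrable_map_measure hexp.aestronglyMeasurable hm.aemeasurable,
      integral_map hm.aemeasurable hexp.aestronglyMeasurable]
    have hint : Integrable (fun x => Real.exp (1 * L x)) G := by
      have h := integrable_exp_mul_gaussianReal (μ := 0) (v := (u ⬝ᵥ S *ᵥ u).toNNReal) 1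
      rw [← hmap] at h
      exact h.comp_measurable L.measurable
    have hmgf := mgf_gaussianReal hmap 1
    rw [Real.coe_toNNReal _ hnn] at hmgf
    simp only [mgf, one_mul, hLx] at hmgf hint
    refine ⟨hint, ?_⟩
    rw [hmgf]
    refine Real.exp_le_exp.2 ?_
    linarith [hle u]
  · rw [covariance_map (measurable_pi_apply i).aestronglyMeasurable
      (measurable_pi_apply j).aestronglyMeasurable hm.aemeasurable]
    exact covariance_eval_multivariateGaussian hS i j

theorem IsSubGaussian.hasSubgaussianMGF {d : ℕ} {D : Measure (Fin d → ℝ)}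
    (hD : IsSubGaussian 1 D) (i : Fin d) : HasSubgaussianMGF (fun x => x i) 1 D := by
  have h : ∀ (t : ℝ) (x : Fin d → ℝ), Pi.single i t ⬝ᵥ x = t * x i := fun t x => by
    rw [single_dotProduct]
  refine ⟨fun t => ?_, fun t => ?_⟩
  · simpa only [h] using (hD (Pi.single i t)).1
  · have := (hD (Pi.single i t)).2
    simp only [h, Pi.single_eq_same] at this
    refine this.trans_eq ?_
    congr 1
    push_cast
    ring

theorem integral_mul_eq_of_hasCovarianceMatrix {d : ℕ} {D : Measure (Fin d → ℝ)}
    [IsProbabilityMeasure D] {S : Matrix (Fin d) (Fin d) ℝ} (hD : IsSubGaussian 1 D)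
    (hS : HasCovarianceMatrix D S) (i j : Fin d) : ∫ x, x i * x j ∂D = S i j := by
  rw [← hS i j, covariance, integral_eq_zero_of_hasSubgaussianMGF (hD.hasSubgaussianMGF i),
    integral_eq_zero_of_hasSubgaussianMGF (hD.hasSubgaussianMGF j)]
  simp

theorem sampleCov_sub_eq {n d : ℕ} (hn : 0 < n) (x : Fin n → Fin d → ℝ) (i j : Fin d) (a : ℝ) :
    sampleCov x i j - a = (1 / (n : ℝ)) * ∑ k, (x k i * x k j - a) := by
  have hn' : (n : ℝ) ≠ 0 := by exact_mod_cast hn.ne'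
  simp only [sampleCov, Matrix.smul_apply, Matrix.sum_apply, Matrix.vecMulVec_apply,
    Finset.sum_sub_distrib, Finset.sum_const, Finset.card_univ, Fintype.card_fin, smul_eq_mul,
    nsmul_eq_mul]
  field_simp

/-- The sample covariance matrix is entrywise close to the covariance matrix. -/
theorem pi_real_exists_entry_far_le {n d : ℕ} (hn : 0 < n) {D : Measure (Fin d → ℝ)}
    [IsProbabilityMeasure D] {S : Matrix (Fin d) (Fin d) ℝ} (hD : IsSubGaussian 1 D)
    (hS : HasCovarianceMatrix D S) {η : ℝ} (hη : 0 ≤ η) (hη1 : η ≤ 1) :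
    (Measure.pi fun _ : Fin n => D).real {x | ∃ i j, η ≤ |sampleCov x i j - S i j|} ≤
      (d : ℝ) ^ 2 * (2 * Real.exp (-(n * η ^ 2 / 10000))) := by
  have hn' : (0 : ℝ) < n := by exact_mod_cast hn
  have hij : ∀ p : Fin d × Fin d, (Measure.pi fun _ : Fin n => D).real
      {x | η ≤ |sampleCov x p.1 p.2 - S p.1 p.2|} ≤ 2 * Real.exp (-(n * η ^ 2 / 10000)) := by
    rintro ⟨i, j⟩
    have h := pi_real_le_abs_sum_le (D := D) (f := fun x => x i * x j - S i j) (by fun_prop)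
      (fun t ht => by
        rw [← integral_mul_eq_of_hasCovarianceMatrix hD hS i j]
        exact mgf_mul_sub_integral_le (hD.hasSubgaussianMGF i) (hD.hasSubgaussianMGF j) ht)
      n hη hη1
    refine le_of_eq_of_le ?_ h
    congr 1
    ext x
    simp only [Set.mem_ofPred_eq]
    rw [sampleCov_sub_eq hn, abs_mul, abs_of_pos (one_div_pos.2 hn'), one_div,
      le_inv_mul_iff₀ hn']
  have hset : {x : Fin n → Fin d → ℝ | ∃ i j, η ≤ |sampleCov x i j - S i j|}
      = ⋃ p : Fin d × Fin d, {x | η ≤ |sampleCov x p.1 p.2 - S p.1 p.2|} := by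
    ext x; simp
  rw [hset]
  refine (measureReal_iUnion_fintype_le _).trans
    ((Finset.sum_le_sum fun p _ => hij p).trans_eq ?_)
  simp [sq]

/-! ### Choice of parameters and conclusion. -/

/-- Only subadditivity is used, so the event about all top eigenvectors need not be shown
measurable. -/
theorem half_le_pi_of_compl_subset {Ω : Type*} [MeasurableSpace Ω] {μ : Measure Ω}
    [IsProbabilityMeasure μ] {A B : Set Ω} (hAB : Aᶜ ⊆ B) (hB : μ.real B ≤ 1 / 2) :
    1 / 2 ≤ μ A := by
  have h1 : 1 ≤ μ.real A + μ.real B := by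
    calc (1 : ℝ) = μ.real Set.univ := by simp
      _ ≤ μ.real (A ∪ B) := measureReal_mono fun x _ => by
          by_cases h : x ∈ A
          · exact Or.inl h
          · exact Or.inr (hAB h)
      _ ≤ _ := measureReal_union_le _ _
  have h2 : (1 / 2 : ℝ) ≤ μ.real A := by linarith
  have h3 := ENNReal.ofReal_le_ofReal h2
  rw [ofReal_measureReal] at h3
  refine le_trans (le_of_eq ?_) h3
  rw [ENNReal.ofReal_div_of_pos (by norm_num)]
  simp

theorem exists_disjoint_finsets {d s m : ℕ} (h : s + 2 * m ≤ d) :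
    ∃ I P Q : Finset (Fin d), I.card = s ∧ P.card = m ∧ Q.card = m ∧ Disjoint I P ∧
      Disjoint I Q ∧ Disjoint P Q := by
  have hd : (Finset.univ : Finset (Fin d)).card = d := by simp
  obtain ⟨I, -, hI⟩ := Finset.exists_subset_card_eq (s := (Finset.univ : Finset (Fin d)))
    (n := s) (by omega)
  obtain ⟨P, hPI, hP⟩ := Finset.exists_subset_card_eq (s := Iᶜ) (n := m) (by
    rw [Finset.card_compl, Fintype.card_fin]; omega)
  obtain ⟨Q, hQ, hQc⟩ := Finset.exists_subset_card_eq (s := (I ∪ P)ᶜ) (n := m) (by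
    have := Finset.card_union_le I P
    rw [Finset.card_compl, Fintype.card_fin]; omega)
  have hIP : Disjoint I P := Finset.subset_compl_iff_disjoint_left.1 hPI
  have hQ' : Disjoint (I ∪ P) Q := Finset.subset_compl_iff_disjoint_left.1 hQ
  rw [Finset.disjoint_union_left] at hQ'
  exact ⟨I, P, Q, hI, hP, hQc, hIP, hQ'.1, hQ'.2⟩

/-- Since `4000² = 4 * 4000000`, the exponent `nτ²/4000000` is at least `4 log d`; the union bound
is then at most `2/d² ≤ 1/2`. -/
theorem sq_mul_exp_le_half {d n : ℕ} {τ : ℝ} (hd : 2 ≤ d) (hn : 0 < n)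
    (hτ : 4000 * Real.sqrt (Real.log d / n) ≤ τ) :
    (d : ℝ) ^ 2 * (2 * Real.exp (-(n * (τ / 20) ^ 2 / 10000))) ≤ 1 / 2 := by
  have hd' : (2 : ℝ) ≤ d := by exact_mod_cast hd
  have hn' : (0 : ℝ) < n := by exact_mod_cast hn
  have hlog : 0 ≤ Real.log d := Real.log_nonneg (by linarith)
  have h1 : 16000000 * (Real.log d / n) ≤ τ ^ 2 := by
    have h := pow_le_pow_left₀ (by positivity) hτ 2
    rw [mul_pow, Real.sq_sqrt (by positivity)] at h
    linarith
  have h2 : 16000000 * Real.log d ≤ n * τ ^ 2 := by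
    have h := mul_le_mul_of_nonneg_left h1 hn'.le
    have e : (n : ℝ) * (16000000 * (Real.log d / n)) = 16000000 * Real.log d := by field_simp
    linarith
  have h3 : Real.exp (-(n * (τ / 20) ^ 2 / 10000)) ≤ ((d : ℝ) ^ 4)⁻¹ := by
    have e : ((d : ℝ) ^ 4)⁻¹ = Real.exp (-(4 * Real.log d)) := by
      rw [Real.exp_neg, mul_comm, Real.exp_mul, Real.exp_log (by linarith)]
      norm_num
    rw [e]
    refine Real.exp_le_exp.2 ?_
    have e2 : n * (τ / 20) ^ 2 / 10000 = n * τ ^ 2 / 4000000 := by ring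
    rw [e2]
    linarith
  calc (d : ℝ) ^ 2 * (2 * Real.exp (-(n * (τ / 20) ^ 2 / 10000)))
      ≤ (d : ℝ) ^ 2 * (2 * ((d : ℝ) ^ 4)⁻¹) := by gcongr
    _ = 2 / (d : ℝ) ^ 2 := by field_simp
    _ ≤ 1 / 2 := by
        rw [div_le_div_iff₀ (by positivity) (by norm_num)]
        nlinarith

end SparsePCA

theorem mainTheorem3 :
    ∃ C₁ C₂ C₃ c : ℝ, 0 < C₁ ∧ 0 < C₂ ∧ 0 < C₃ ∧ 0 < c ∧
      ∀ (s d n : ℕ) (τ : ℝ), 1 ≤ s →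
        C₁ * (s : ℝ) ^ 2 * Real.log d ≤ n →
        0 < τ → C₂ * Real.sqrt (Real.log d / n) ≤ τ → τ ≤ c →
        (s : ℝ) + C₃ / τ ≤ d →
        ∃ (v : Fin d → ℝ) (S : Matrix (Fin d) (Fin d) ℝ),
          SparsePCA.GeneralModel s v S ∧ SparsePCA.nnz v = s ∧
          (∃ D : MeasureTheory.Measure (Fin d → ℝ), MeasureTheory.IsProbabilityMeasure D ∧
            SparsePCA.IsSubGaussian 1 D ∧ SparsePCA.HasCovarianceMatrix D S) ∧
          ∀ D : MeasureTheory.Measure (Fin d → ℝ), MeasureTheory.IsProbabilityMeasure D →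
            SparsePCA.IsSubGaussian 1 D → SparsePCA.HasCovarianceMatrix D S →
            1 / 2 ≤ (MeasureTheory.Measure.pi fun _ : Fin n => D)
              {x | ∀ u, SparsePCA.IsCovThreshOutput τ x u → SparsePCA.sinSqAngle u v = 1} := by
  refine ⟨1, 4000, 1, 1 / 20, by norm_num, by norm_num, by norm_num, by norm_num, ?_⟩
  intro s d n τ hs hn hτ hτn hτc hd
  -- Rounding up adds at most `τ ≤ 1/20` to `mτ`, which therefore stays in `[0.35, 0.4]`. Also `m ≥
  -- 0.35 * 20 = 7`, and `2m ≤ 0.8/τ` leaves room for `P` and `Q` outside `I`.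
  set m : ℕ := ⌈0.35 / τ⌉₊ with hm
  have hmτ : 0.35 ≤ m * τ := by
    rw [← div_le_iff₀ hτ]; exact Nat.le_ceil _
  have hm_lt : (m : ℝ) < 0.35 / τ + 1 := Nat.ceil_lt_add_one (by positivity)
  have hmτ' : m * τ ≤ 0.4 := by
    have h := mul_le_mul_of_nonneg_right hm_lt.le hτ.le
    rw [add_mul, div_mul_cancel₀ _ hτ.ne'] at h
    linarith
  have hm7 : 7 ≤ m := by
    have h : (7 : ℝ) ≤ m := by
      by_contra! h
      nlinarith
    exact_mod_cast h
  have hsmd : s + 2 * m ≤ d := by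
    have h1 : 2 * (m : ℝ) ≤ 1 / τ := by
      rw [le_div_iff₀ hτ]; linarith
    have h2 : (s : ℝ) + 2 * m ≤ d := by linarith
    exact_mod_cast h2
  have hd2 : 2 ≤ d := by omega
  -- At `n = 0` the quotient `log d / n` is 0 by convention and the lower bound on `τ` says nothing;
  -- the sample-size bound excludes this, as `log d > 0`.
  have hn0 : 0 < n := by
    have hd' : (2 : ℝ) ≤ d := by exact_mod_cast hd2
    have hlog : 0 < Real.log d := Real.log_pos (by linarith)
    have hs' : (0 : ℝ) < s := by exact_mod_cast hs
    have : (0 : ℝ) < n := lt_of_lt_of_le (by positivity) hn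
    exact_mod_cast this
  obtain ⟨I, P, Q, hI, hP, hQ, hIP, hIQ, hPQ⟩ := SparsePCA.exists_disjoint_finsets hsmd
  have hmodel := SparsePCA.generalModel_spikedCov hs (by omega) hI hP hQ hIP hIQ hPQ
  refine ⟨SparsePCA.spike I s, SparsePCA.spikedCov I P Q s m, hmodel,
    SparsePCA.nnz_spike hs hI, SparsePCA.exists_subGaussian_of_quadForm_le hmodel.posSemidef
      fun x => (SparsePCA.quadForm_spikedCov_bounds hs (by omega) hI hP hQ hIP hIQ hPQ x).2.1, ?_⟩
  intro D hDp hD hS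
  refine SparsePCA.half_le_pi_of_compl_subset ?_
    ((SparsePCA.pi_real_exists_entry_far_le hn0 hD hS (η := τ / 20) (by positivity)
      (by linarith)).trans (SparsePCA.sq_mul_exp_le_half hd2 hn0 hτn))
  intro x hx
  by_contra hfar
  refine hx fun u hu => ?_
  refine SparsePCA.sinSqAngle_eq_one_of_close hs hm7 hτ hmτ hmτ' hτc hI hP hQ hIP hIQ hPQ
    (fun i j => ?_) (SparsePCA.thresholdedCov_isHermitian τ x) hu
  by_contra! h
  exact hfar ⟨i, j, h.le⟩
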